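/- Let $d\ge 0$ be an integer, let $\kappa=(\kappa_1,\dots,\kappa_{d+1})$ with $\kappa_i\ge 0$ for all $i$, and let $S^d=\{x\in\mathbb R^{d+1}:\|x\|=1\}$ with surface measure $d\omega$. Put $h_\kappa(x)=\prod_{i=1}^{d+1}|x_i|^{\kappa_i}$. Let $V_\kappa$ be the intertwining operator of the group $\mathbb Z_2^{d+1}$, $$V_\kappa g(x)=c_\kappa\int_{[-1,1]^{d+1}} g(x_1t_1,\dots,x_{d+1}t_{d+1})\prod_{i=1}^{d+1}(1+t_i)(1-t_i^2)^{\kappa_i-1}\,dt,$$ where $c_\kappa$ is determined by $V_\kappa 1=1$; if $\kappa_i=0$, the normalized measure in the variable $t_i$ is replaced by its limit as $\kappa_i\to0^+$, the unit mass at $t_i=1$. For $x\in S^d$ and $0<\theta\le\pi$ let $$c(x,\theta)=\{y\in S^d:\langle x,y\rangle\ge\cos\theta\},\qquad B(x,\theta)=\{y\in\mathbb R^{d+1}:\|y\|\le 1,\ \langle x,y\rangle\ge\cos\theta\},$$ and for $f\in L^1(h_\kappa^2\,d\omega;S^d)$ (real- or complex-valued) define, with values in $[0,\infty]$, $$\mathcal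 M_\kappa f(x)=\sup_{0<\theta\le\pi}\frac{\int_{S^d}|f(y)|\,V_\kappa[\chi_{B(x,\theta)}](y)\,h_\kappa^2(y)\,d\omega(y)}{\int_{S^d}V_\kappa[\chi_{B(x,\theta)}](y)\,h_\kappa^2(y)\,d\omega(y)},\qquad M_\kappa f(x)=\sup_{0<\theta\le\pi}\frac{\int_{c(x,\theta)}|f(y)|\,h_\kappa^2(y)\,d\omega(y)}{\int_{c(x,\theta)}h_\kappa^2(y)\,d\omega(y)}.$$ Then there is a finite constant $c$, depending only on $d$ and $\kappa$, such that for every $f\in L^1(h_\kappa^2\,d\omega;S^d)$ and every $x\in S^d$, $$\mathcal M_\kappa f(x)\le c\sum_{\varepsilon\in\{1,-1\}^{d+1}}M_\kappa f(x\varepsilon),\qquad x\varepsilon=(x_1\varepsilon_1,\dots,x_{d+1}\varepsilon_{d+1}).$$ -/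

import Mathlib

open MeasureTheory Set
open scoped ENNReal NNReal

noncomputable section

namespace ProductWeight

/-- The unit sphere `S^d` of `ℝ^{d+1}`. -/
abbrev Sph (d : ℕ) : Type := Metric.sphere (0 : EuclideanSpace ℝ (Fin (d + 1))) 1

/-- The surface (Lebesgue) measure `dω` on `S^d`. -/
def surfaceMeasure (d : ℕ) : Measure (Sph d) :=
  (volume : Measure (EuclideanSpace ℝ (Fin (d + 1)))).toSphere

variable {d : ℕ}

/-- The product weight `h_κ(x) = ∏ i, |x_i| ^ κ_i` (with `|x_i| ^ 0 = 1`). -/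
def weight (κ : Fin (d + 1) → ℝ) (x : EuclideanSpace ℝ (Fin (d + 1))) : ℝ :=
  ∏ i, |x i| ^ κ i

/-- The measure `h_κ² dω` on `S^d`. -/
def weightedMeasure (κ : Fin (d + 1) → ℝ) : Measure (Sph d) :=
  (surfaceMeasure d).withDensity fun y => ENNReal.ofReal (weight κ y ^ 2)

/-- The measure `(1 + t) (1 - t²) ^ (k - 1) dt` on `[-1, 1]`, not normalized. -/
def jacobiMeasure (k : ℝ) : Measure ℝ :=
  (volume.restrict (Icc (-1) 1)).withDensity
    fun t => ENNReal.ofReal ((1 + t) * (1 - t ^ 2) ^ (k - 1))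

/-- The one-dimensional factor of the intertwining operator: the probability measure proportional
to `(1 + t) (1 - t²) ^ (k - 1) dt` on `[-1, 1]` if `k > 0`, and its limit as `k → 0`, the unit
mass at `1`, if `k = 0`. -/
def intertwiningFactor (k : ℝ) : Measure ℝ :=
  if k = 0 then Measure.dirac 1 else (jacobiMeasure k univ)⁻¹ • jacobiMeasure k

/-- The intertwining operator `V_κ` of the group `ℤ₂^{d+1}`:
`V_κ g(x) = c_κ ∫_{[-1,1]^{d+1}} g(x₁t₁, …, x_{d+1}t_{d+1}) ∏ i, (1 + t_i)(1 - t_i²)^{κ_i - 1} dt`,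
where `V_κ 1 = 1`. -/
def intertwining (κ : Fin (d + 1) → ℝ) (g : EuclideanSpace ℝ (Fin (d + 1)) → ℝ)
    (x : EuclideanSpace ℝ (Fin (d + 1))) : ℝ :=
  ∫ t : Fin (d + 1) → ℝ, g (WithLp.toLp 2 fun i => x i * t i)
    ∂Measure.pi fun i => intertwiningFactor (κ i)

/-- The spherical cap `c(x, θ) = {y ∈ S^d : ⟨x, y⟩ ≥ cos θ}`. -/
def cap (x : Sph d) (θ : ℝ) : Set (Sph d) :=
  {y | Real.cos θ ≤ inner ℝ (x : EuclideanSpace ℝ (Fin (d + 1))) y}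

/-- The solid cap `B(x, θ) = {y ∈ B^{d+1} : ⟨x, y⟩ ≥ cos θ}`. -/
def solidCap (x : Sph d) (θ : ℝ) : Set (EuclideanSpace ℝ (Fin (d + 1))) :=
  {y | ‖y‖ ≤ 1 ∧ Real.cos θ ≤ inner ℝ (x : EuclideanSpace ℝ (Fin (d + 1))) y}

/-- `V_κ[χ_{B(x,θ)}](y)`, a number of `[0, 1]`, as an extended nonnegative real. -/
def capKernel (κ : Fin (d + 1) → ℝ) (x : Sph d) (θ : ℝ) (y : Sph d) : ℝ≥0∞ :=
  ENNReal.ofReal (intertwining κ ((solidCap x θ).indicator fun _ => (1 : ℝ)) y)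

/-- The maximal function `𝓜_κ f` defined through the intertwining operator. It may be infinite. -/
def intertwiningMaximal {𝕜 : Type*} [RCLike 𝕜] (κ : Fin (d + 1) → ℝ) (f : Sph d → 𝕜)
    (x : Sph d) : ℝ≥0∞ :=
  ⨆ θ ∈ Ioc (0 : ℝ) Real.pi,
    (∫⁻ y, ‖f y‖ₑ * capKernel κ x θ y ∂weightedMeasure κ) /
      ∫⁻ y, capKernel κ x θ y ∂weightedMeasure κ

/-- The weighted Hardy–Littlewood maximal function `M_κ f`. It may be infinite. -/
def hlMaximal {𝕜 : Type*} [RCLike 𝕜] (κ : Fin (d + 1) → ℝ) (f : Sph d → 𝕜)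
    (x : Sph d) : ℝ≥0∞ :=
  ⨆ θ ∈ Ioc (0 : ℝ) Real.pi,
    (∫⁻ y in cap x θ, ‖f y‖ₑ ∂weightedMeasure κ) / weightedMeasure κ (cap x θ)

/-- The action `xε = (x₁ε₁, …, x_{d+1}ε_{d+1})` of a sign vector `ε` on `S^d`. -/
def signChange (x : Sph d) (ε : Fin (d + 1) → ℤˣ) : Sph d :=
  ⟨WithLp.toLp 2 fun i => (x : EuclideanSpace ℝ (Fin (d + 1))) i * ((ε i : ℤ) : ℝ), by
    have hx : ‖(x : EuclideanSpace ℝ (Fin (d + 1)))‖ = 1 := by simp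
    have hε : ∀ i, (((ε i : ℤ) : ℝ)) ^ 2 = 1 := fun i => by
      rcases Int.units_eq_one_or (ε i) with h | h <;> simp [h]
    refine mem_sphere_zero_iff_norm.2 (Eq.trans ?_ hx)
    rw [EuclideanSpace.norm_eq, EuclideanSpace.norm_eq]
    simp [mul_pow, hε]⟩

end ProductWeight

end

/-!
Put `r = 2 sin (θ / 2)`, so that the cap `c(x, θ)` is the ball of radius `r` around `x` in `S^d`.
Only points with `|t_i| ≤ 1` enter `V_κ`, so `V_κ[χ_B(x,θ)](y) ≠ 0` forces
`∑ |x_i| |y_i| ≥ cos θ`, i.e. `y` lies in `c(xε, θ)` for the `ε` matching the signs of `x` and `y`.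
The kernel is everywhere at most a multiple of `∏ (r / (|x_i| + r)) ^ (2 κ_i)`, and at least
a multiple of it where `‖y - x‖ ≤ r / 2`. Finally the weighted measure of a ball of radius `r`
around `x` is comparable to `r ^ d ∏ (|x_i| + r) ^ (2 κ_i)`, which does not see the signs of the
`x_i`; so the `h_κ²`-measures of the caps `c(xε, θ)` are all controlled by that of the ball of
radius `r / 2` around `x`, on which the kernel is bounded below.
-/

noncomputable section

namespace ProductWeight

open Metric Module NormedSpace
open scoped Pointwise

section Sector

variable {E : Type*} [NormedAddCommGroup E] [NormedSpace ℝ E]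

lemma dist_normalize_le {x : E} (hx : ‖x‖ = 1) (w : E) :
    dist (normalize w) x ≤ 2 * dist w x := by
  have hself : dist (normalize w) w ≤ dist w x := by
    rcases eq_or_ne w 0 with rfl | hw
    · simp [hx]
    · calc dist (normalize w) w = ‖(1 - ‖w‖) • normalize w‖ := by
            rw [sub_smul, one_smul, norm_smul_normalize, dist_eq_norm]
        _ = |‖w‖ - ‖x‖| := by
            rw [norm_smul, norm_normalize hw, mul_one, Real.norm_eq_abs, abs_sub_comm, hx]
        _ ≤ dist w x := by
            rw [dist_eq_norm]
            exact abs_norm_sub_norm_le w x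
  linarith [dist_triangle (normalize w) w x]

lemma Ioo_smul_closedBall_subset_closedBall (x : sphere (0 : E) 1) (r : ℝ) :
    Ioo 1 (1 + r) • ((↑) '' closedBall x r) ⊆ closedBall (x : E) (2 * r) := by
  rintro _ ⟨t, ht, _, ⟨y, hy, rfl⟩, rfl⟩
  have hty : dist (t • (y : E)) y ≤ r := by
    calc dist (t • (y : E)) y = ‖(t - 1) • (y : E)‖ := by rw [dist_eq_norm, sub_smul, one_smul]
      _ = t - 1 := by
        rw [norm_smul, norm_eq_of_mem_sphere, mul_one, Real.norm_of_nonneg (by linarith [ht.1])]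
      _ ≤ r := by linarith [ht.2]
  have hyx : dist (y : E) x ≤ r := hy
  rw [mem_closedBall]
  linarith [dist_triangle (t • (y : E)) y x]

lemma ball_subset_Ioo_smul_closedBall (x : sphere (0 : E) 1) {r : ℝ} (hr : r ≤ 1) :
    ball (x : E) r ⊆ Ioo (1 - r) (1 + r) • ((↑) '' closedBall x (2 * r)) := by
  intro v hv
  have hvx : dist v x < r := hv
  have hnorm : |‖v‖ - 1| < r := by
    have h := abs_norm_sub_norm_le v x
    rw [norm_eq_of_mem_sphere, ← dist_eq_norm] at h
    exact h.trans_lt hvx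
  obtain ⟨hlow, hup⟩ := abs_lt.1 hnorm
  have hv0 : v ≠ 0 := norm_pos_iff.1 (by linarith)
  refine ⟨‖v‖, ⟨by linarith, by linarith⟩, _,
    ⟨⟨normalize v, by simp [norm_normalize hv0]⟩, ?_, rfl⟩, norm_smul_normalize v⟩
  calc dist (normalize v) (x : E) ≤ 2 * dist v x := dist_normalize_le (norm_eq_of_mem_sphere x) v
    _ ≤ 2 * r := by gcongr

variable [FiniteDimensional ℝ E]

lemma finrank_sub_one_add_one (x : sphere (0 : E) 1) : finrank ℝ E - 1 + 1 = finrank ℝ E :=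
  have : Nontrivial E := ⟨x, 0, ne_zero_of_mem_unit_sphere x⟩
  Nat.sub_add_cancel finrank_pos

variable [MeasurableSpace E] [BorelSpace E]
  (μ : Measure E) [μ.IsAddHaarMeasure]

lemma measure_Ioo_smul_coe_image {s : Set (sphere (0 : E) 1)} (hs : MeasurableSet s) {a : ℝ}
    (ha : 0 ≤ a) (b : ℝ) :
    μ (Ioo a b • ((↑) '' s)) =
      μ.toSphere s * ∫⁻ t in Ioo a b, ENNReal.ofReal (t ^ (finrank ℝ E - 1)) := by
  let I : Set (Ioi (0 : ℝ)) := (↑) ⁻¹' Ioo a b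
  have hI : MeasurableSet I := measurable_subtype_coe measurableSet_Ioo
  have hcoe : ((↑) '' I : Set ℝ) = Ioo a b := by
    rw [Subtype.image_preimage_coe]
    exact inter_eq_right.2 fun t ht => ha.trans_lt ht.1
  have hsector : ((↑) '' (homeomorphUnitSphereProd E ⁻¹' s ×ˢ I) : Set E) =
      Ioo a b • ((↑) '' s) := by
    rw [← hcoe, ← image2_smul, image2_image_right, ← Homeomorph.image_symm, image_image,
      image2_image_left, image2_swap, ← image_prod]
    rfl
  rw [← hsector, ← comap_subtype_coe_apply (measurableSet_singleton _).compl,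
    μ.measurePreserving_homeomorphUnitSphereProd.measure_preimage
      (hs.prod hI).nullMeasurableSet, Measure.prod_prod, Measure.volumeIoiPow,
    withDensity_apply _ hI, setLIntegral_subtype measurableSet_Ioi _
      fun t : ℝ => ENNReal.ofReal (t ^ (finrank ℝ E - 1)), hcoe]

lemma toSphere_closedBall_le (x : sphere (0 : E) 1) {r : ℝ} (hr : 0 < r) :
    μ.toSphere (closedBall x r) ≤
      2 ^ finrank ℝ E * μ (ball 0 1) * ENNReal.ofReal r ^ (finrank ℝ E - 1) := by
  have hshell : ENNReal.ofReal r ≤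
      ∫⁻ t in Ioo 1 (1 + r), ENNReal.ofReal (t ^ (finrank ℝ E - 1)) := by
    calc ENNReal.ofReal r = ∫⁻ _ in Ioo 1 (1 + r), 1 := by simp
      _ ≤ _ := setLIntegral_mono' measurableSet_Ioo fun t ht =>
        ENNReal.one_le_ofReal.2 (one_le_pow₀ ht.1.le)
  have hmul : μ.toSphere (closedBall x r) * ENNReal.ofReal r ≤
      2 ^ finrank ℝ E * μ (ball 0 1) * ENNReal.ofReal r ^ (finrank ℝ E - 1) *
        ENNReal.ofReal r := by
    calc μ.toSphere (closedBall x r) * ENNReal.ofReal r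
        ≤ μ (Ioo 1 (1 + r) • ((↑) '' closedBall x r)) := by
          rw [measure_Ioo_smul_coe_image μ measurableSet_closedBall zero_le_one]
          gcongr
      _ ≤ μ (closedBall (x : E) (2 * r)) :=
          measure_mono (Ioo_smul_closedBall_subset_closedBall x r)
      _ = _ := by
          rw [μ.addHaar_closedBall _ (by positivity), ENNReal.ofReal_pow (by positivity),
            ENNReal.ofReal_mul zero_le_two, ENNReal.ofReal_ofNat, mul_pow,
            mul_assoc _ _ (ENNReal.ofReal r), ← pow_succ, finrank_sub_one_add_one x]
          ring
  exact (ENNReal.mul_le_mul_iff_left (by simpa using hr) ENNReal.ofReal_ne_top).1 hmul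

lemma le_toSphere_closedBall (x : sphere (0 : E) 1) {r : ℝ} (hr : 0 < r) (hr1 : r ≤ 1) :
    ENNReal.ofReal r ^ (finrank ℝ E - 1) * μ (ball 0 1) ≤
      2 ^ finrank ℝ E * μ.toSphere (closedBall x (2 * r)) := by
  have hshell : ∫⁻ t in Ioo (1 - r) (1 + r), ENNReal.ofReal (t ^ (finrank ℝ E - 1)) ≤
      2 ^ finrank ℝ E * ENNReal.ofReal r := by
    calc _ ≤ ∫⁻ _ in Ioo (1 - r) (1 + r), 2 ^ (finrank ℝ E - 1) := by
          refine setLIntegral_mono' measurableSet_Ioo fun t ht => ?_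
          have ht0 : 0 ≤ t := by linarith [ht.1]
          rw [ENNReal.ofReal_pow ht0]
          gcongr
          exact ENNReal.ofReal_le_of_le_toReal (by simp; linarith [ht.2])
      _ = 2 ^ (finrank ℝ E - 1) * (2 * ENNReal.ofReal r) := by
          rw [setLIntegral_const, Real.volume_Ioo, show 1 + r - (1 - r) = 2 * r by ring,
            ENNReal.ofReal_mul zero_le_two, ENNReal.ofReal_ofNat]
      _ = _ := by rw [← mul_assoc, ← pow_succ, finrank_sub_one_add_one x]
  have hmul : ENNReal.ofReal r ^ (finrank ℝ E - 1) * μ (ball 0 1) * ENNReal.ofReal r ≤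
      2 ^ finrank ℝ E * μ.toSphere (closedBall x (2 * r)) * ENNReal.ofReal r := by
    calc ENNReal.ofReal r ^ (finrank ℝ E - 1) * μ (ball 0 1) * ENNReal.ofReal r
        = μ (ball (x : E) r) := by
          rw [μ.addHaar_ball_of_pos _ hr, ENNReal.ofReal_pow hr.le, mul_right_comm, ← pow_succ,
            finrank_sub_one_add_one x]
      _ ≤ μ (Ioo (1 - r) (1 + r) • ((↑) '' closedBall x (2 * r))) :=
          measure_mono (ball_subset_Ioo_smul_closedBall x hr1)
      _ ≤ μ.toSphere (closedBall x (2 * r)) * (2 ^ finrank ℝ E * ENNReal.ofReal r) := by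
          rw [measure_Ioo_smul_coe_image μ measurableSet_closedBall (by linarith)]
          gcongr
      _ = _ := by ring
  exact (ENNReal.mul_le_mul_iff_left (by simpa using hr) ENNReal.ofReal_ne_top).1 hmul

end Sector

section Jacobi

lemma setLIntegral_Icc_one_sub_rpow {k s : ℝ} (hk : 0 < k) (hs : 0 ≤ s) :
    ∫⁻ t in Icc (1 - s) 1, ENNReal.ofReal ((1 - t) ^ (k - 1)) = ENNReal.ofReal (s ^ k / k) := by
  have hle : 1 - s ≤ 1 := by linarith
  have hint : IntervalIntegrable (fun t : ℝ => (1 - t) ^ (k - 1)) volume (1 - s) 1 := by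
    simpa using (intervalIntegral.intervalIntegrable_rpow' (a := s) (b := 0)
      (by linarith : -1 < k - 1)).comp_sub_left 1
  have hval : ∫ t in (1 - s)..1, (1 - t) ^ (k - 1) = s ^ k / k := by
    rw [intervalIntegral.integral_comp_sub_left (fun t => t ^ (k - 1)) 1,
      integral_rpow (Or.inl (by linarith))]
    simp [Real.zero_rpow hk.ne']
  rw [← hval, intervalIntegral.integral_of_le hle, ← Measure.restrict_congr_set Ioc_ae_eq_Icc,
    ofReal_integral_eq_lintegral_ofReal
      ((intervalIntegrable_iff_integrableOn_Ioc_of_le hle).1 hint)]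
  filter_upwards [ae_restrict_mem measurableSet_Ioc] with t ht
  exact Real.rpow_nonneg (by linarith [ht.2]) _

variable {k : ℝ}

lemma jacobiMeasure_apply {s : Set ℝ} (hs : MeasurableSet s) :
    jacobiMeasure k s =
      ∫⁻ t in s ∩ Icc (-1) 1, ENNReal.ofReal ((1 + t) * (1 - t ^ 2) ^ (k - 1)) := by
  rw [jacobiMeasure, withDensity_apply _ hs, Measure.restrict_restrict hs]

lemma jacobi_density_eq {t : ℝ} (ht : t ∈ Ioc (-1) 1) :
    (1 + t) * (1 - t ^ 2) ^ (k - 1) = (1 + t) ^ k * (1 - t) ^ (k - 1) := by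
  have hpos : 0 < 1 + t := by linarith [ht.1]
  rw [show 1 - t ^ 2 = (1 + t) * (1 - t) by ring,
    Real.mul_rpow hpos.le (by linarith [ht.2]), ← mul_assoc, Real.rpow_sub_one hpos.ne',
    mul_div_cancel₀ _ hpos.ne']

lemma jacobiMeasure_Icc {s : ℝ} (hs1 : s ≤ 1) :
    jacobiMeasure k (Icc (1 - s) 1) =
      ∫⁻ t in Icc (1 - s) 1, ENNReal.ofReal ((1 + t) ^ k * (1 - t) ^ (k - 1)) := by
  have hsub : Icc (1 - s) 1 ⊆ Icc (-1) 1 := Icc_subset_Icc_left (by linarith)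
  rw [jacobiMeasure_apply measurableSet_Icc, inter_eq_left.2 hsub]
  refine setLIntegral_congr_fun measurableSet_Icc fun t ht => ?_
  simp only [jacobi_density_eq ⟨by linarith [ht.1], ht.2⟩]

lemma le_jacobiMeasure_Icc (hk : 0 < k) {s : ℝ} (hs : 0 ≤ s) (hs1 : s ≤ 1) :
    ENNReal.ofReal (s ^ k / k) ≤ jacobiMeasure k (Icc (1 - s) 1) := by
  rw [jacobiMeasure_Icc hs1, ← setLIntegral_Icc_one_sub_rpow hk hs]
  refine setLIntegral_mono' measurableSet_Icc fun t ht => ENNReal.ofReal_le_ofReal ?_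
  exact le_mul_of_one_le_left (Real.rpow_nonneg (by linarith [ht.2]) _)
    (Real.one_le_rpow (by linarith [ht.1]) hk.le)

lemma jacobiMeasure_Icc_le (hk : 0 < k) {s : ℝ} (hs : 0 ≤ s) (hs1 : s ≤ 1) :
    jacobiMeasure k (Icc (1 - s) 1) ≤ ENNReal.ofReal (2 ^ k * (s ^ k / k)) := by
  rw [jacobiMeasure_Icc hs1, ENNReal.ofReal_mul (by positivity),
    ← setLIntegral_Icc_one_sub_rpow hk hs, ← lintegral_const_mul' _ _ ENNReal.ofReal_ne_top]
  refine setLIntegral_mono' measurableSet_Icc fun t ht => ?_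
  have ht0 : 0 ≤ 1 + t := by linarith [ht.1]
  have ht1 : 1 + t ≤ 2 := by linarith [ht.2]
  rw [ENNReal.ofReal_mul (by positivity)]
  gcongr

lemma jacobiMeasure_Icc_neg_le {a : ℝ} (ha : 0 ≤ a) :
    jacobiMeasure k (Icc (-1) (-a)) ≤ jacobiMeasure k (Icc a 1) := by
  have hneg : Icc (-1) (-a) = Neg.neg ⁻¹' Icc a 1 := by simp
  have hreflect := (Measure.measurePreserving_neg volume).setLIntegral_comp_preimage_emb
    (MeasurableEquiv.neg ℝ).measurableEmbedding
    (fun t => ENNReal.ofReal ((1 + t) * (1 - t ^ 2) ^ (k - 1))) (Icc a 1)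
  rw [jacobiMeasure_apply measurableSet_Icc, jacobiMeasure_apply measurableSet_Icc,
    inter_eq_left.2 (Icc_subset_Icc_right (by linarith)),
    inter_eq_left.2 (Icc_subset_Icc_left (by linarith)), ← hreflect, ← hneg]
  refine setLIntegral_mono' measurableSet_Icc fun t ht => ?_
  rw [neg_sq]
  refine ENNReal.ofReal_le_ofReal (mul_le_mul_of_nonneg_right (by linarith [ht.2]) ?_)
  exact Real.rpow_nonneg (by nlinarith [ht.1, ht.2]) _

lemma jacobiMeasure_one_sub_le_abs_le_of_le_one (hk : 0 < k) {s : ℝ} (hs : 0 ≤ s) (hs1 : s ≤ 1) :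
    jacobiMeasure k {t | 1 - s ≤ |t|} ≤ 2 * ENNReal.ofReal (2 ^ k * (s ^ k / k)) := by
  have hmeas : MeasurableSet {t : ℝ | 1 - s ≤ |t|} := measurableSet_le (by fun_prop) (by fun_prop)
  have hsplit : {t | 1 - s ≤ |t|} ∩ Icc (-1) 1 ⊆ Icc (1 - s) 1 ∪ Icc (-1) (-(1 - s)) := by
    rintro t ⟨hst, ht⟩
    rcases le_abs.1 (show 1 - s ≤ |t| from hst) with h | h
    · exact Or.inl ⟨h, ht.2⟩
    · exact Or.inr ⟨ht.1, by linarith⟩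
  calc jacobiMeasure k {t | 1 - s ≤ |t|} = jacobiMeasure k ({t | 1 - s ≤ |t|} ∩ Icc (-1) 1) := by
        rw [jacobiMeasure_apply hmeas, jacobiMeasure_apply (hmeas.inter measurableSet_Icc),
          inter_assoc, inter_self]
    _ ≤ jacobiMeasure k (Icc (1 - s) 1) + jacobiMeasure k (Icc (-1) (-(1 - s))) :=
        (measure_mono hsplit).trans (measure_union_le _ _)
    _ ≤ 2 * jacobiMeasure k (Icc (1 - s) 1) := by
        rw [two_mul]
        exact add_le_add le_rfl (jacobiMeasure_Icc_neg_le (by linarith))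
    _ ≤ _ := by
        gcongr
        exact jacobiMeasure_Icc_le hk hs hs1

lemma jacobiMeasure_univ_le (hk : 0 < k) :
    jacobiMeasure k univ ≤ 2 * ENNReal.ofReal (2 ^ k * (1 / k)) := by
  simpa using jacobiMeasure_one_sub_le_abs_le_of_le_one hk zero_le_one le_rfl

lemma jacobiMeasure_one_sub_le_abs_le (hk : 0 < k) {s : ℝ} (hs : 0 ≤ s) :
    jacobiMeasure k {t | 1 - s ≤ |t|} ≤ 2 * ENNReal.ofReal (2 ^ k * (s ^ k / k)) := by
  rcases le_total s 1 with hs1 | hs1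
  · exact jacobiMeasure_one_sub_le_abs_le_of_le_one hk hs hs1
  · refine (measure_mono (subset_univ _)).trans ((jacobiMeasure_univ_le hk).trans ?_)
    gcongr
    exact Real.one_le_rpow hs1 hk.le

lemma jacobiMeasure_univ_ne_zero (hk : 0 < k) : jacobiMeasure k univ ≠ 0 := by
  have hpos : 0 < ENNReal.ofReal (1 ^ k / k) := by simpa using hk
  exact (hpos.trans_le ((le_jacobiMeasure_Icc hk zero_le_one le_rfl).trans
    (measure_mono (subset_univ _)))).ne'

lemma jacobiMeasure_univ_ne_top (hk : 0 < k) : jacobiMeasure k univ ≠ ∞ :=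
  ((jacobiMeasure_univ_le hk).trans_lt (by finiteness)).ne

lemma intertwiningFactor_zero : intertwiningFactor 0 = Measure.dirac 1 := if_pos rfl

lemma intertwiningFactor_of_pos (hk : 0 < k) :
    intertwiningFactor k = (jacobiMeasure k univ)⁻¹ • jacobiMeasure k := if_neg hk.ne'

lemma isProbabilityMeasure_intertwiningFactor (hk : 0 ≤ k) :
    IsProbabilityMeasure (intertwiningFactor k) := by
  rcases hk.eq_or_lt with rfl | hk
  · rw [intertwiningFactor_zero]
    infer_instance
  · constructor
    rw [intertwiningFactor_of_pos hk, Measure.smul_apply, smul_eq_mul,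
      ENNReal.inv_mul_cancel (jacobiMeasure_univ_ne_zero hk) (jacobiMeasure_univ_ne_top hk)]

lemma ae_intertwiningFactor_abs_le_one (hk : 0 ≤ k) :
    ∀ᵐ t ∂intertwiningFactor k, |t| ≤ 1 := by
  rcases hk.eq_or_lt with rfl | hk
  · simp [intertwiningFactor_zero]
  · rw [intertwiningFactor_of_pos hk]
    refine Measure.ae_smul_measure ?_ _
    refine (withDensity_absolutelyContinuous _ _).ae_le ?_
    filter_upwards [ae_restrict_mem measurableSet_Icc] with t ht using abs_le.2 ht

lemma exists_intertwiningFactor_one_sub_le_abs_le (hk : 0 ≤ k) : ∃ C : ℝ≥0, ∀ s : ℝ, 0 ≤ s →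
    intertwiningFactor k {t | 1 - s ≤ |t|} ≤ C * ENNReal.ofReal (s ^ k) := by
  have := isProbabilityMeasure_intertwiningFactor hk
  rcases hk.eq_or_lt with rfl | hk
  · exact ⟨1, fun s _ => by simpa using prob_le_one⟩
  · refine ⟨(jacobiMeasure k univ)⁻¹.toNNReal * (2 * (2 ^ k / k).toNNReal), fun s hs => ?_⟩
    calc intertwiningFactor k {t | 1 - s ≤ |t|}
        = (jacobiMeasure k univ)⁻¹ * jacobiMeasure k {t | 1 - s ≤ |t|} := by
          rw [intertwiningFactor_of_pos hk, Measure.smul_apply, smul_eq_mul]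
      _ ≤ (jacobiMeasure k univ)⁻¹ * (2 * ENNReal.ofReal (2 ^ k * (s ^ k / k))) := by
          gcongr
          exact jacobiMeasure_one_sub_le_abs_le hk hs
      _ = _ := by
          rw [ENNReal.coe_mul, ENNReal.coe_toNNReal
            (ENNReal.inv_ne_top.2 (jacobiMeasure_univ_ne_zero hk)), mul_assoc, ENNReal.coe_mul,
            show 2 ^ k * (s ^ k / k) = 2 ^ k / k * s ^ k by ring,
            ENNReal.ofReal_mul (by positivity), ← mul_assoc 2]
          rfl

lemma exists_le_intertwiningFactor_Icc (hk : 0 ≤ k) : ∃ C : ℝ≥0, ∀ s : ℝ, 0 ≤ s → s ≤ 1 →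
    ENNReal.ofReal (s ^ k) ≤ C * intertwiningFactor k (Icc (1 - s) 1) := by
  rcases hk.eq_or_lt with rfl | hk
  · exact ⟨1, fun s hs _ => by simp [intertwiningFactor_zero, hs]⟩
  · have h0 := jacobiMeasure_univ_ne_zero hk
    have htop := jacobiMeasure_univ_ne_top hk
    refine ⟨k.toNNReal * (jacobiMeasure k univ).toNNReal, fun s hs hs1 => ?_⟩
    calc ENNReal.ofReal (s ^ k) = ENNReal.ofReal k * ENNReal.ofReal (s ^ k / k) := by
          rw [← ENNReal.ofReal_mul hk.le, mul_div_cancel₀ _ hk.ne']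
      _ ≤ ENNReal.ofReal k * jacobiMeasure k (Icc (1 - s) 1) := by
          gcongr
          exact le_jacobiMeasure_Icc hk hs hs1
      _ = _ := by
          rw [intertwiningFactor_of_pos hk, Measure.smul_apply, smul_eq_mul, ENNReal.coe_mul,
            ENNReal.coe_toNNReal htop, mul_assoc, ENNReal.mul_inv_cancel_left h0 htop]
          rfl

end Jacobi

section Products

variable {ι : Type*} [Fintype ι] {κ : ι → ℝ}

lemma ae_pi_intertwiningFactor_abs_le_one (hκ : ∀ i, 0 ≤ κ i) :
    ∀ᵐ t ∂Measure.pi fun i => intertwiningFactor (κ i), ∀ i, |t i| ≤ 1 := by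
  have := fun i => isProbabilityMeasure_intertwiningFactor (hκ i)
  exact ae_all_iff.2 fun i =>
    (Measure.tendsto_eval_ae_ae (μ := fun i => intertwiningFactor (κ i))).eventually
      (ae_intertwiningFactor_abs_le_one (hκ i))

lemma exists_pi_intertwiningFactor_one_sub_le_abs_le (hκ : ∀ i, 0 ≤ κ i) :
    ∃ C : ℝ≥0, ∀ s : ι → ℝ, (∀ i, 0 ≤ s i) →
      Measure.pi (fun i => intertwiningFactor (κ i)) (univ.pi fun i => {t | 1 - s i ≤ |t|}) ≤
        C * ∏ i, ENNReal.ofReal (s i ^ κ i) := by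
  have := fun i => isProbabilityMeasure_intertwiningFactor (hκ i)
  choose C hC using fun i => exists_intertwiningFactor_one_sub_le_abs_le (hκ i)
  refine ⟨∏ i, C i, fun s hs => ?_⟩
  rw [Measure.pi_pi, ENNReal.ofNNReal_finsetProd, ← Finset.prod_mul_distrib]
  exact Finset.prod_le_prod' fun i _ => hC i (s i) (hs i)

lemma exists_le_pi_intertwiningFactor_Icc (hκ : ∀ i, 0 ≤ κ i) :
    ∃ C : ℝ≥0, ∀ s : ι → ℝ, (∀ i, 0 ≤ s i) → (∀ i, s i ≤ 1) →
      ∏ i, ENNReal.ofReal (s i ^ κ i) ≤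
        C * Measure.pi (fun i => intertwiningFactor (κ i)) (univ.pi fun i => Icc (1 - s i) 1) := by
  have := fun i => isProbabilityMeasure_intertwiningFactor (hκ i)
  choose C hC using fun i => exists_le_intertwiningFactor_Icc (hκ i)
  refine ⟨∏ i, C i, fun s hs hs1 => ?_⟩
  rw [Measure.pi_pi, ENNReal.ofNNReal_finsetProd, ← Finset.prod_mul_distrib]
  exact Finset.prod_le_prod' fun i _ => hC i (s i) (hs i) (hs1 i)

lemma prod_ofReal_const_mul_rpow (κ : ι → ℝ) (a : ℝ≥0) {s : ι → ℝ} (hs : ∀ i, 0 ≤ s i) :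
    ∏ i, ENNReal.ofReal ((a * s i) ^ κ i) =
      (∏ i, a ^ κ i : ℝ≥0) * ∏ i, ENNReal.ofReal (s i ^ κ i) := by
  rw [ENNReal.ofNNReal_finsetProd, ← Finset.prod_mul_distrib]
  refine Finset.prod_congr rfl fun i _ => ?_
  rw [Real.mul_rpow a.coe_nonneg (hs i), ENNReal.ofReal_mul (by positivity), ← NNReal.coe_rpow,
    ENNReal.ofReal_coe_nnreal]

end Products

section Coordinates

variable {ι : Type*} [Fintype ι]

/-- The vector of the absolute values of the coordinates of `x`, each increased by `r`. Its weight
is, up to constants, the largest value of the weight on the ball of centre `x` and radius `r`. -/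
def fatten (x : EuclideanSpace ℝ ι) (r : ℝ) : EuclideanSpace ℝ ι :=
  WithLp.toLp 2 fun i => |x i| + r

lemma abs_apply_le_add_dist (x y : EuclideanSpace ℝ ι) (i : ι) : |y i| ≤ |x i| + dist y x := by
  have h : |y i - x i| ≤ dist y x := by
    rw [dist_eq_norm]
    exact PiLp.norm_apply_le (y - x) i
  linarith [abs_sub_abs_le_abs_sub (y i) (x i)]

lemma inner_eq_sum (x y : EuclideanSpace ℝ ι) : inner ℝ x y = ∑ i, x i * y i := by
  simp [PiLp.inner_apply, mul_comm]

lemma sum_abs_mul_abs_le (x y : EuclideanSpace ℝ ι) : ∑ i, |x i| * |y i| ≤ ‖x‖ * ‖y‖ := by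
  simpa [EuclideanSpace.norm_eq] using
    Real.sum_mul_le_sqrt_mul_sqrt Finset.univ (fun i => |x i|) fun i => |y i|

lemma exists_norm_eq_forall_abs_add_eq (x : EuclideanSpace ℝ ι) {δ : ℝ} (hδ : 0 ≤ δ) :
    ∃ u : EuclideanSpace ℝ ι, ‖u‖ = √(Fintype.card ι) * δ ∧ ∀ i, |x i + u i| = |x i| + δ := by
  let u : EuclideanSpace ℝ ι := WithLp.toLp 2 fun i => if 0 ≤ x i then δ else -δ
  have hu : ∀ i, |u i| = δ := fun i => by
    by_cases hi : 0 ≤ x i <;> simp [u, hi, abs_of_nonneg hδ]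
  refine ⟨u, ?_, fun i => ?_⟩
  · simp [EuclideanSpace.norm_eq, hu, Real.sqrt_sq hδ]
  · rcases le_or_gt 0 (x i) with hi | hi
    · simp only [u, if_pos hi, abs_of_nonneg hi, abs_of_nonneg (add_nonneg hi hδ)]
    · rw [abs_of_neg hi, abs_of_nonpos] <;> simp only [u, if_neg hi.not_ge] <;> linarith

end Coordinates

section Weight

variable {κ : Fin (d + 1) → ℝ}

lemma weight_nonneg (κ : Fin (d + 1) → ℝ) (x : EuclideanSpace ℝ (Fin (d + 1))) :
    0 ≤ weight κ x :=
  Finset.prod_nonneg fun _ _ => by positivity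

lemma weight_le_weight (hκ : ∀ i, 0 ≤ κ i) {x y : EuclideanSpace ℝ (Fin (d + 1))}
    (h : ∀ i, |x i| ≤ |y i|) : weight κ x ≤ weight κ y :=
  Finset.prod_le_prod (fun _ _ => by positivity) fun i _ =>
    Real.rpow_le_rpow (abs_nonneg _) (h i) (hκ i)

lemma weight_smul (κ : Fin (d + 1) → ℝ) (a : ℝ) (x : EuclideanSpace ℝ (Fin (d + 1))) :
    weight κ (a • x) = (∏ i, |a| ^ κ i) * weight κ x := by
  simp only [weight, PiLp.smul_apply, smul_eq_mul, abs_mul,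
    Real.mul_rpow (abs_nonneg a) (abs_nonneg _), Finset.prod_mul_distrib]

lemma exists_surfaceMeasure_closedBall_le (d : ℕ) : ∃ C : ℝ≥0, ∀ (x : Sph d) (r : ℝ), 0 < r →
    surfaceMeasure d (closedBall x r) ≤ C * ENNReal.ofReal r ^ d := by
  let E := EuclideanSpace ℝ (Fin (d + 1))
  have hfin : (2 : ℝ≥0∞) ^ (d + 1) * volume (ball (0 : E) 1) ≠ ∞ :=
    ENNReal.mul_ne_top (by finiteness) measure_ball_lt_top.ne
  refine ⟨(2 ^ (d + 1) * volume (ball (0 : E) 1)).toNNReal, fun x r hr => ?_⟩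
  rw [ENNReal.coe_toNNReal hfin]
  simpa [surfaceMeasure] using toSphere_closedBall_le volume x hr

lemma exists_le_surfaceMeasure_closedBall (d : ℕ) :
    ∃ C : ℝ≥0, ∀ (x : Sph d) (r : ℝ), 0 < r → r ≤ 2 →
      ENNReal.ofReal r ^ d ≤ C * surfaceMeasure d (closedBall x r) := by
  let E := EuclideanSpace ℝ (Fin (d + 1))
  set v : ℝ≥0∞ := volume (ball (0 : E) 1)
  have hv0 : v ≠ 0 := (measure_ball_pos volume _ one_pos).ne'
  have hvtop : v ≠ ∞ := measure_ball_lt_top.ne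
  refine ⟨2 ^ d * (v⁻¹.toNNReal * 2 ^ (d + 1)), fun x r hr hr2 => ?_⟩
  have hhalf : ENNReal.ofReal (r / 2) ^ d * v ≤
      2 ^ (d + 1) * surfaceMeasure d (closedBall x r) := by
    have hr1 : r / 2 ≤ 1 := by linarith
    have h := le_toSphere_closedBall volume x (half_pos hr) hr1
    rwa [finrank_euclideanSpace_fin, Nat.add_sub_cancel, mul_div_cancel₀ _ two_ne_zero] at h
  calc ENNReal.ofReal r ^ d = 2 ^ d * (v⁻¹ * (ENNReal.ofReal (r / 2) ^ d * v)) := by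
        rw [mul_comm _ v, ENNReal.inv_mul_cancel_left hv0 hvtop, ← mul_pow, ← ENNReal.ofReal_ofNat,
          ← ENNReal.ofReal_mul zero_le_two, mul_div_cancel₀ _ two_ne_zero]
    _ ≤ 2 ^ d * (v⁻¹ * (2 ^ (d + 1) * surfaceMeasure d (closedBall x r))) := by gcongr
    _ = _ := by
        push_cast
        rw [ENNReal.coe_toNNReal (ENNReal.inv_ne_top.2 hv0)]
        ring

lemma weightedMeasure_le_ofReal_sq_mul {s : Set (Sph d)} (hs : MeasurableSet s) {c : ℝ}
    (h : ∀ y ∈ s, weight κ y ≤ c) :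
    weightedMeasure κ s ≤ ENNReal.ofReal (c ^ 2) * surfaceMeasure d s := by
  rw [weightedMeasure, withDensity_apply _ hs, ← setLIntegral_const]
  exact setLIntegral_mono' hs fun y hy =>
    ENNReal.ofReal_le_ofReal (pow_le_pow_left₀ (weight_nonneg κ _) (h y hy) 2)

lemma ofReal_sq_mul_le_weightedMeasure {s : Set (Sph d)} (hs : MeasurableSet s) {c : ℝ}
    (hc : 0 ≤ c) (h : ∀ y ∈ s, c ≤ weight κ y) :
    ENNReal.ofReal (c ^ 2) * surfaceMeasure d s ≤ weightedMeasure κ s := by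
  rw [weightedMeasure, withDensity_apply _ hs, ← setLIntegral_const]
  exact setLIntegral_mono' hs fun y hy =>
    ENNReal.ofReal_le_ofReal (pow_le_pow_left₀ hc (h y hy) 2)

lemma exists_weightedMeasure_closedBall_le (hκ : ∀ i, 0 ≤ κ i) :
    ∃ C : ℝ≥0, ∀ (x : Sph d) (r : ℝ), 0 < r →
      weightedMeasure κ (closedBall x r) ≤
        C * (ENNReal.ofReal r ^ d * ENNReal.ofReal (weight κ (fatten x r) ^ 2)) := by
  obtain ⟨C, hC⟩ := exists_surfaceMeasure_closedBall_le d
  refine ⟨C, fun x r hr => ?_⟩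
  have hweight : ∀ y ∈ closedBall x r, weight κ y ≤ weight κ (fatten x r) := fun y hy =>
    weight_le_weight hκ fun i =>
      calc |y.1 i| ≤ |x.1 i| + dist y.1 x.1 := abs_apply_le_add_dist x.1 y.1 i
        _ ≤ |x.1 i| + r := by gcongr; exact hy
        _ ≤ |fatten x.1 r i| := le_abs_self _
  calc weightedMeasure κ (closedBall x r)
      ≤ ENNReal.ofReal (weight κ (fatten x r) ^ 2) * surfaceMeasure d (closedBall x r) :=
        weightedMeasure_le_ofReal_sq_mul measurableSet_closedBall hweight
    _ ≤ ENNReal.ofReal (weight κ (fatten x r) ^ 2) * (C * ENNReal.ofReal r ^ d) := by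
        gcongr
        exact hC x r hr
    _ = _ := by ring

-- `z` is the renormalisation of `x` moved away from all coordinate hyperplanes.
lemma exists_abs_apply_ge_half (x : Sph d) {r : ℝ} (hr : 0 < r) (hr2 : r ≤ 2) :
    ∃ z : Sph d, dist z x ≤ r / 8 ∧ ∀ i, (|x.1 i| + r / (16 * √(d + 1))) / 2 ≤ |z.1 i| := by
  have hx : ‖x.1‖ = 1 := norm_eq_of_mem_sphere x
  obtain ⟨u, hu, hxu⟩ := exists_norm_eq_forall_abs_add_eq x.1
    (by positivity : 0 ≤ r / (16 * √(d + 1)))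
  replace hu : ‖u‖ = r / 16 := by
    rw [hu, Fintype.card_fin, Nat.cast_add_one]
    field_simp
  have hdist : dist (x.1 + u) x.1 = r / 16 := by simp [hu]
  obtain ⟨hlow, hup⟩ := abs_le.1 (abs_norm_sub_norm_le (x.1 + u) x.1)
  rw [add_sub_cancel_left, hu, hx] at hlow hup
  have hpos : 0 < ‖x.1 + u‖ := by linarith
  refine ⟨⟨normalize (x.1 + u), by simp [norm_normalize (norm_pos_iff.1 hpos)]⟩, ?_, fun i => ?_⟩
  · rw [Subtype.dist_eq]
    linarith [dist_normalize_le hx (x.1 + u)]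
  · calc (|x.1 i| + r / (16 * √(d + 1))) / 2 = 2⁻¹ * |x.1 i + u i| := by rw [hxu]; ring
      _ ≤ ‖x.1 + u‖⁻¹ * |x.1 i + u i| := by gcongr; linarith
      _ = |normalize (x.1 + u) i| := by
        simp [NormedSpace.normalize, ← mul_add, abs_mul]

lemma exists_closedBall_subset_forall_mul_fatten_le (d : ℕ) :
    ∃ a : ℝ, 0 < a ∧ a ≤ 1 ∧ ∀ (x : Sph d) (r : ℝ), 0 < r → r ≤ 2 →
      ∃ z : Sph d, closedBall z (a * r) ⊆ closedBall x (r / 2) ∧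
        ∀ y ∈ closedBall z (a * r), ∀ i, a * (|x.1 i| + r) ≤ |y.1 i| := by
  have hone : 1 ≤ √((d : ℝ) + 1) := Real.one_le_sqrt.2 (by simp)
  have ha : (64 * √((d : ℝ) + 1))⁻¹ ≤ 64⁻¹ := by gcongr; linarith
  have ha0 : 0 < (64 * √((d : ℝ) + 1))⁻¹ := by positivity
  set a : ℝ := (64 * √((d : ℝ) + 1))⁻¹ with ha_def
  refine ⟨a, ha0, by linarith, fun x r hr hr2 => ?_⟩
  obtain ⟨z, hzx, hz⟩ := exists_abs_apply_ge_half x hr hr2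
  refine ⟨z, closedBall_subset_closedBall' (by nlinarith), fun y hy i => ?_⟩
  have hzi := hz i
  rw [show r / (16 * √((d : ℝ) + 1)) = 4 * (a * r) by rw [ha_def]; field_simp; norm_num] at hzi
  have hyz := abs_apply_le_add_dist y.1 z.1 i
  have hdist : dist z.1 y.1 ≤ a * r := mem_closedBall'.1 hy
  nlinarith [abs_nonneg (x.1 i)]

lemma exists_le_weightedMeasure_closedBall_half (hκ : ∀ i, 0 ≤ κ i) :
    ∃ C : ℝ≥0, ∀ (x : Sph d) (r : ℝ), 0 < r → r ≤ 2 →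
      ENNReal.ofReal r ^ d * ENNReal.ofReal (weight κ (fatten x r) ^ 2) ≤
        C * weightedMeasure κ (closedBall x (r / 2)) := by
  obtain ⟨C, hC⟩ := exists_le_surfaceMeasure_closedBall d
  obtain ⟨a, ha0, ha1, hball⟩ := exists_closedBall_subset_forall_mul_fatten_le d
  set p : ℝ := ∏ i, |a| ^ κ i
  have hp : 0 < p := Finset.prod_pos fun i _ => by positivity
  refine ⟨(a ^ d * p ^ 2)⁻¹.toNNReal * C, fun x r hr hr2 => ?_⟩
  obtain ⟨z, hsub, hz⟩ := hball x r hr hr2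
  set W : ℝ := weight κ (fatten x r)
  have hweight : ∀ y ∈ closedBall z (a * r), p * W ≤ weight κ y := fun y hy => by
    rw [← weight_smul]
    refine weight_le_weight hκ fun i => ?_
    simpa [fatten, abs_mul, abs_of_pos ha0, abs_of_nonneg (by positivity : 0 ≤ |x.1 i| + r)]
      using hz y hy i
  have hlow := (ofReal_sq_mul_le_weightedMeasure measurableSet_closedBall
    (mul_nonneg hp.le (weight_nonneg κ _)) hweight).trans (measure_mono hsub)
  calc ENNReal.ofReal r ^ d * ENNReal.ofReal (W ^ 2)
      = ENNReal.ofReal (a ^ d * p ^ 2)⁻¹ *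
          (ENNReal.ofReal ((p * W) ^ 2) * ENNReal.ofReal (a * r) ^ d) := by
        rw [← ENNReal.ofReal_pow hr.le, ← ENNReal.ofReal_pow (by positivity),
          ← ENNReal.ofReal_mul (by positivity), ← ENNReal.ofReal_mul (by positivity),
          ← ENNReal.ofReal_mul (by positivity)]
        congr 1
        field_simp
        ring
    _ ≤ ENNReal.ofReal (a ^ d * p ^ 2)⁻¹ * (ENNReal.ofReal ((p * W) ^ 2) *
          (C * surfaceMeasure d (closedBall z (a * r)))) := by
        gcongr
        exact hC z _ (by positivity) (by nlinarith)
    _ = ENNReal.ofReal (a ^ d * p ^ 2)⁻¹ * C *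
          (ENNReal.ofReal ((p * W) ^ 2) * surfaceMeasure d (closedBall z (a * r))) := by ring
    _ ≤ _ := by
        rw [ENNReal.coe_mul]
        gcongr
        rfl

lemma abs_signChange (x : Sph d) (ε : Fin (d + 1) → ℤˣ) (i : Fin (d + 1)) :
    |(signChange x ε).1 i| = |x.1 i| := by
  rcases Int.units_eq_one_or (ε i) with h | h <;> simp [signChange, h]

lemma fatten_signChange (x : Sph d) (ε : Fin (d + 1) → ℤˣ) (r : ℝ) :
    fatten (signChange x ε).1 r = fatten x.1 r := by
  simp only [fatten, abs_signChange]

lemma exists_weightedMeasure_closedBall_signChange_le (hκ : ∀ i, 0 ≤ κ i) :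
    ∃ C : ℝ≥0, ∀ (x : Sph d) (ε : Fin (d + 1) → ℤˣ) (r : ℝ), 0 < r → r ≤ 2 →
      weightedMeasure κ (closedBall (signChange x ε) r) ≤
        C * weightedMeasure κ (closedBall x (r / 2)) := by
  obtain ⟨C, hC⟩ := exists_weightedMeasure_closedBall_le hκ
  obtain ⟨C', hC'⟩ := exists_le_weightedMeasure_closedBall_half hκ
  refine ⟨C * C', fun x ε r hr hr2 => (hC (signChange x ε) r hr).trans ?_⟩
  rw [fatten_signChange, ENNReal.coe_mul, mul_assoc]
  exact mul_le_mul_right (hC' x r hr hr2) _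

lemma isFiniteMeasure_weightedMeasure (hκ : ∀ i, 0 ≤ κ i) :
    IsFiniteMeasure (weightedMeasure κ) := by
  obtain ⟨C, hC⟩ := exists_weightedMeasure_closedBall_le hκ
  constructor
  obtain h | ⟨⟨x⟩⟩ := isEmpty_or_nonempty (Sph d)
  · simp
  · have huniv : closedBall x 2 = univ := eq_univ_of_forall fun y => by
      simpa [one_add_one_eq_two, Subtype.dist_eq] using
        dist_le_norm_add_norm (y : EuclideanSpace ℝ (Fin (d + 1))) x
    rw [← huniv]
    exact (hC x 2 two_pos).trans_lt (by finiteness)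

end Weight

section Cap

/-- The length of the chord of a central angle `θ` of the unit circle: the spherical cap `c(x, θ)`
is the closed ball of centre `x` and radius `chord θ` for the distance of `ℝ^{d+1}`. -/
def chord (θ : ℝ) : ℝ := 2 * Real.sin (θ / 2)

variable {θ : ℝ}

lemma chord_pos (hθ : θ ∈ Ioc 0 Real.pi) : 0 < chord θ :=
  mul_pos two_pos (Real.sin_pos_of_pos_of_lt_pi (by linarith [hθ.1]) (by linarith [hθ.1, hθ.2]))

lemma chord_le_two (θ : ℝ) : chord θ ≤ 2 := by
  unfold chord
  linarith [Real.sin_le_one (θ / 2)]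

lemma cos_eq_one_sub_chord_sq (θ : ℝ) : Real.cos θ = 1 - chord θ ^ 2 / 2 := by
  rw [chord, mul_pow, Real.sin_sq_eq_half_sub, mul_div_cancel₀ _ two_ne_zero]
  ring

lemma inner_eq_one_sub_dist_sq (x y : Sph d) : inner ℝ x.1 y.1 = 1 - dist y x ^ 2 / 2 := by
  have h := norm_sub_sq_real y.1 x.1
  rw [norm_eq_of_mem_sphere, norm_eq_of_mem_sphere, real_inner_comm] at h
  rw [Subtype.dist_eq, dist_eq_norm, h]
  ring

lemma cap_eq_closedBall (x : Sph d) (hθ : θ ∈ Ioc 0 Real.pi) :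
    cap x θ = closedBall x (chord θ) := by
  ext y
  rw [mem_closedBall, ← sq_le_sq₀ dist_nonneg (chord_pos hθ).le]
  change Real.cos θ ≤ inner ℝ x.1 y.1 ↔ _
  rw [cos_eq_one_sub_chord_sq, inner_eq_one_sub_dist_sq]
  constructor <;> intro <;> linarith

lemma measurableSet_cap (x : Sph d) (θ : ℝ) : MeasurableSet (cap x θ) :=
  (isClosed_le continuous_const
    (continuous_const.inner continuous_subtype_val)).measurableSet

lemma exists_inner_signChange_eq (x y : Sph d) :
    ∃ ε : Fin (d + 1) → ℤˣ, inner ℝ (signChange x ε).1 y.1 = ∑ i, |x.1 i| * |y.1 i| := by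
  refine ⟨fun i => if 0 ≤ x.1 i * y.1 i then 1 else -1, ?_⟩
  rw [inner_eq_sum]
  refine Finset.sum_congr rfl fun i _ => ?_
  rw [← abs_mul]
  rcases le_or_gt 0 (x.1 i * y.1 i) with hi | hi
  · simp [signChange, hi, abs_of_nonneg hi]
  · simp [signChange, hi.not_ge, abs_of_neg hi]

end Cap

section CapKernel

variable {κ : Fin (d + 1) → ℝ} {x y : Sph d} {θ r : ℝ} {t : Fin (d + 1) → ℝ}

/-- The parameters `t` of the integral defining `V_κ` at `y` for which the dilated point
`(y₁t₁, …, y_{d+1}t_{d+1})` lies in the solid cap `B(x, θ)`. -/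
def capParameters (x : Sph d) (θ : ℝ) (y : Sph d) : Set (Fin (d + 1) → ℝ) :=
  {t | WithLp.toLp 2 (fun i => y.1 i * t i) ∈ solidCap x θ}

lemma mem_capParameters :
    t ∈ capParameters x θ y ↔
      ‖WithLp.toLp 2 fun i => y.1 i * t i‖ ≤ 1 ∧ Real.cos θ ≤ ∑ i, x.1 i * (y.1 i * t i) := by
  simp only [capParameters, solidCap, mem_ofPred_eq, inner_eq_sum]

lemma measurableSet_capParameters (x : Sph d) (θ : ℝ) (y : Sph d) :
    MeasurableSet (capParameters x θ y) := by
  have hsolid : IsClosed (solidCap x θ) := by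
    rw [solidCap, ofPred_and]
    exact (isClosed_le continuous_norm continuous_const).inter
      (isClosed_le continuous_const (continuous_const.inner continuous_id))
  exact (hsolid.preimage (by fun_prop)).measurableSet

lemma capKernel_eq (hκ : ∀ i, 0 ≤ κ i) (x : Sph d) (θ : ℝ) (y : Sph d) :
    capKernel κ x θ y = Measure.pi (fun i => intertwiningFactor (κ i)) (capParameters x θ y) := by
  have := fun i => isProbabilityMeasure_intertwiningFactor (hκ i)
  have hindicator : (fun t : Fin (d + 1) → ℝ => (solidCap x θ).indicator (fun _ => (1 : ℝ))
      (WithLp.toLp 2 fun i => y.1 i * t i)) = (capParameters x θ y).indicator 1 := rfl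
  rw [capKernel, intertwining, hindicator,
    integral_indicator_one (measurableSet_capParameters x θ y), ofReal_measureReal]

lemma cos_le_sum_of_mem_capParameters (h : t ∈ capParameters x θ y) :
    Real.cos θ ≤ ∑ i, |x.1 i| * |y.1 i| * |t i| :=
  (mem_capParameters.1 h).2.trans <| Finset.sum_le_sum fun i _ => by
    rw [← abs_mul, ← abs_mul, mul_assoc]
    exact le_abs_self _

lemma exists_mem_cap_signChange_of_mem_capParameters (ht : ∀ i, |t i| ≤ 1)
    (h : t ∈ capParameters x θ y) : ∃ ε : Fin (d + 1) → ℤˣ, y ∈ cap (signChange x ε) θ := by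
  obtain ⟨ε, hε⟩ := exists_inner_signChange_eq x y
  refine ⟨ε, (cos_le_sum_of_mem_capParameters h).trans (le_of_le_of_eq ?_ hε.symm)⟩
  exact Finset.sum_le_sum fun i _ => mul_le_of_le_one_right (by positivity) (ht i)

lemma exists_mem_cap_signChange_of_capKernel_ne_zero (hκ : ∀ i, 0 ≤ κ i)
    (h : capKernel κ x θ y ≠ 0) : ∃ ε : Fin (d + 1) → ℤˣ, y ∈ cap (signChange x ε) θ := by
  by_contra hne
  refine h ?_
  rw [capKernel_eq hκ, measure_eq_zero_iff_ae_notMem]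
  filter_upwards [ae_pi_intertwiningFactor_abs_le_one hκ] with t ht htc
  exact hne (exists_mem_cap_signChange_of_mem_capParameters ht htc)

/-- The square of the size of `r` relative to the `i`-th coordinate of `x`. For `r = chord θ` it is,
up to a constant, how far from `±1` the `i`-th coordinate of a `t ∈ capParameters x θ y` can be. -/
def relScale (x : EuclideanSpace ℝ (Fin (d + 1))) (r : ℝ) (i : Fin (d + 1)) : ℝ :=
  (r / (|x i| + r)) ^ 2

lemma relScale_nonneg (x : EuclideanSpace ℝ (Fin (d + 1))) (r : ℝ) (i : Fin (d + 1)) :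
    0 ≤ relScale x r i :=
  sq_nonneg _

lemma relScale_le_one (x : EuclideanSpace ℝ (Fin (d + 1))) (hr : 0 ≤ r) (i : Fin (d + 1)) :
    relScale x r i ≤ 1 :=
  pow_le_one₀ (by positivity) (div_le_one_of_le₀ (by linarith [abs_nonneg (x i)]) (by positivity))

lemma sq_mul_relScale (x : EuclideanSpace ℝ (Fin (d + 1))) (hr : 0 < r) (i : Fin (d + 1)) :
    (|x i| + r) ^ 2 * relScale x r i = r ^ 2 := by
  unfold relScale
  field_simp

lemma abs_mul_abs_mul_one_sub_abs_le (ht : ∀ i, |t i| ≤ 1) (h : t ∈ capParameters x θ y)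
    (j : Fin (d + 1)) : |x.1 j| * |y.1 j| * (1 - |t j|) ≤ chord θ ^ 2 / 2 := by
  have hcos := cos_le_sum_of_mem_capParameters h
  have hone : ∑ i, |x.1 i| * |y.1 i| ≤ 1 := by simpa using sum_abs_mul_abs_le x.1 y.1
  calc |x.1 j| * |y.1 j| * (1 - |t j|) ≤ ∑ i, |x.1 i| * |y.1 i| * (1 - |t i|) :=
        Finset.single_le_sum (f := fun i => |x.1 i| * |y.1 i| * (1 - |t i|))
          (fun i _ => mul_nonneg (by positivity) (sub_nonneg.2 (ht i))) (Finset.mem_univ j)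
    _ = ∑ i, |x.1 i| * |y.1 i| - ∑ i, |x.1 i| * |y.1 i| * |t i| := by
        simp only [mul_sub, mul_one, Finset.sum_sub_distrib]
    _ ≤ chord θ ^ 2 / 2 := by linarith [cos_eq_one_sub_chord_sq θ]

lemma mul_add_sq_le_of_mul_mul_le {u v w r : ℝ} (hu : 0 ≤ u) (hr : 0 ≤ r) (hw : 0 ≤ w)
    (hw1 : w ≤ 1) (huv : u ≤ v + r) (h : u * v * w ≤ r ^ 2 / 2) :
    w * (u + r) ^ 2 ≤ 9 * r ^ 2 := by
  rcases le_total u (2 * r) with hur | hur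
  · calc w * (u + r) ^ 2 ≤ 1 * (2 * r + r) ^ 2 := by gcongr
      _ = 9 * r ^ 2 := by ring
  · have huw : u * (u / 2) * w ≤ r ^ 2 / 2 := le_trans (by gcongr; linarith) h
    calc w * (u + r) ^ 2 ≤ w * (u + u / 2) ^ 2 := by gcongr; linarith
      _ ≤ 9 * r ^ 2 := by nlinarith

lemma one_sub_relScale_le_abs (hθ : θ ∈ Ioc 0 Real.pi) (ht : ∀ i, |t i| ≤ 1)
    (h : t ∈ capParameters x θ y) (j : Fin (d + 1)) :
    1 - 9 * relScale x.1 (chord θ) j ≤ |t j| := by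
  have hr := chord_pos hθ
  obtain ⟨ε, hε⟩ := exists_mem_cap_signChange_of_mem_capParameters ht h
  have hxy : |x.1 j| ≤ |y.1 j| + chord θ := by
    rw [← abs_signChange x ε]
    refine (abs_apply_le_add_dist y.1 _ j).trans ?_
    gcongr
    rw [cap_eq_closedBall _ hθ] at hε
    exact mem_closedBall'.1 hε
  have hkey := mul_add_sq_le_of_mul_mul_le (abs_nonneg (x.1 j)) hr.le (sub_nonneg.2 (ht j))
    (by linarith [abs_nonneg (t j)]) hxy (abs_mul_abs_mul_one_sub_abs_le ht h j)
  rw [← sq_mul_relScale x.1 hr j, mul_left_comm, mul_comm (1 - |t j|)] at hkey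
  linarith [le_of_mul_le_mul_left hkey (by positivity)]

/-- The order of magnitude of `V_κ[χ_{B(x, θ)}]` near `x` when `r = chord θ`. -/
def kernelSize (κ : Fin (d + 1) → ℝ) (x : EuclideanSpace ℝ (Fin (d + 1))) (r : ℝ) : ℝ≥0∞ :=
  ∏ i, ENNReal.ofReal (relScale x r i ^ κ i)

lemma kernelSize_ne_top (κ : Fin (d + 1) → ℝ) (x : EuclideanSpace ℝ (Fin (d + 1))) (r : ℝ) :
    kernelSize κ x r ≠ ∞ :=
  ENNReal.prod_ne_top fun _ _ => ENNReal.ofReal_ne_top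

lemma exists_capKernel_le (hκ : ∀ i, 0 ≤ κ i) :
    ∃ C : ℝ≥0, ∀ (x y : Sph d), ∀ θ ∈ Ioc 0 Real.pi,
      capKernel κ x θ y ≤ C * kernelSize κ x (chord θ) := by
  obtain ⟨C, hC⟩ := exists_pi_intertwiningFactor_one_sub_le_abs_le hκ
  refine ⟨C * ∏ i, 9 ^ κ i, fun x y θ hθ => ?_⟩
  calc capKernel κ x θ y
      = Measure.pi (fun i => intertwiningFactor (κ i)) (capParameters x θ y) :=
        capKernel_eq hκ x θ y
    _ ≤ Measure.pi (fun i => intertwiningFactor (κ i))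
          (univ.pi fun i => {t | 1 - (9 : ℝ≥0) * relScale x.1 (chord θ) i ≤ |t|}) := by
        refine measure_mono_ae ?_
        filter_upwards [ae_pi_intertwiningFactor_abs_le_one hκ] with t ht htc i _
        exact one_sub_relScale_le_abs hθ ht htc i
    _ ≤ C * ∏ i, ENNReal.ofReal (((9 : ℝ≥0) * relScale x.1 (chord θ) i) ^ κ i) :=
        hC _ fun i => mul_nonneg (NNReal.coe_nonneg 9) (relScale_nonneg _ _ i)
    _ = _ := by
        rw [prod_ofReal_const_mul_rpow κ 9 (relScale_nonneg _ _), ENNReal.coe_mul, mul_assoc]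
        rfl

lemma norm_toLp_mul_le_norm (y : EuclideanSpace ℝ (Fin (d + 1))) (ht : ∀ i, |t i| ≤ 1) :
    ‖WithLp.toLp 2 fun i => y i * t i‖ ≤ ‖y‖ := by
  simp only [EuclideanSpace.norm_eq, norm_mul, Real.norm_eq_abs]
  gcongr with i
  exact mul_le_of_le_one_right (abs_nonneg _) (ht i)

lemma apply_mul_apply_le_sq {x y : Sph d} (hy : dist y x ≤ r) (i : Fin (d + 1)) :
    x.1 i * y.1 i ≤ (|x.1 i| + r) ^ 2 := by
  have hr : 0 ≤ r := dist_nonneg.trans hy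
  have hyi : |y.1 i| ≤ |x.1 i| + r := (abs_apply_le_add_dist x.1 y.1 i).trans (by gcongr; exact hy)
  calc x.1 i * y.1 i ≤ |x.1 i| * |y.1 i| := (le_abs_self _).trans_eq (abs_mul _ _)
    _ ≤ (|x.1 i| + r) * (|x.1 i| + r) := by gcongr; linarith
    _ = _ := (sq _).symm

lemma pi_Icc_subset_capParameters (hθ : θ ∈ Ioc 0 Real.pi) (hy : dist y x ≤ chord θ / 2)
    {a : ℝ} (ha : 0 ≤ a) (had : (d + 1) * a ≤ 3 / 8) :
    (univ.pi fun i => Icc (1 - a * relScale x.1 (chord θ) i) 1) ⊆ capParameters x θ y := by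
  have hr := chord_pos hθ
  set r := chord θ
  intro t ht
  have ht1 : ∀ i, t i ≤ 1 := fun i => (ht i (mem_univ i)).2
  have htlow : ∀ i, 1 - t i ≤ a * relScale x.1 r i := fun i => by
    linarith [(ht i (mem_univ i)).1]
  have habs : ∀ i, |t i| ≤ 1 := fun i => abs_le.2 ⟨by
    nlinarith [htlow i, relScale_le_one x.1 hr.le i, relScale_nonneg x.1 r i], ht1 i⟩
  have hterm : ∀ i, x.1 i * y.1 i * (1 - t i) ≤ a * r ^ 2 := fun i =>
    calc x.1 i * y.1 i * (1 - t i) ≤ (|x.1 i| + r) ^ 2 * (1 - t i) :=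
          mul_le_mul_of_nonneg_right (apply_mul_apply_le_sq (by linarith) i) (sub_nonneg.2 (ht1 i))
      _ ≤ (|x.1 i| + r) ^ 2 * (a * relScale x.1 r i) := by gcongr; exact htlow i
      _ = a * r ^ 2 := by rw [mul_left_comm, sq_mul_relScale x.1 hr]
  have hinner : 1 - (r / 2) ^ 2 / 2 ≤ ∑ i, x.1 i * y.1 i := by
    rw [← inner_eq_sum, inner_eq_one_sub_dist_sq]
    gcongr
  refine mem_capParameters.2 ⟨(norm_toLp_mul_le_norm y.1 habs).trans_eq (by simp), ?_⟩
  calc Real.cos θ = 1 - r ^ 2 / 2 := cos_eq_one_sub_chord_sq θ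
    _ ≤ ∑ i, x.1 i * y.1 i - (d + 1) * a * r ^ 2 := by nlinarith [sq_nonneg r]
    _ = ∑ i, x.1 i * y.1 i - ∑ _i : Fin (d + 1), a * r ^ 2 := by simp [mul_assoc]
    _ ≤ ∑ i, x.1 i * y.1 i - ∑ i, x.1 i * y.1 i * (1 - t i) :=
        sub_le_sub_left (Finset.sum_le_sum fun i _ => hterm i) _
    _ = ∑ i, x.1 i * (y.1 i * t i) := by
        rw [← Finset.sum_sub_distrib]
        exact Finset.sum_congr rfl fun i _ => by ring

lemma exists_kernelSize_le_capKernel (hκ : ∀ i, 0 ≤ κ i) :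
    ∃ C : ℝ≥0, ∀ (x y : Sph d), ∀ θ ∈ Ioc 0 Real.pi, dist y x ≤ chord θ / 2 →
      kernelSize κ x (chord θ) ≤ C * capKernel κ x θ y := by
  obtain ⟨C, hC⟩ := exists_le_pi_intertwiningFactor_Icc hκ
  let a : ℝ≥0 := 3 / (8 * (d + 1))
  have ha0 : 0 < a := by positivity
  have had : ((d : ℝ) + 1) * a = 3 / 8 := by simp only [a]; push_cast; field_simp
  have ha1 : (a : ℝ) ≤ 1 := by nlinarith [a.coe_nonneg, (Nat.cast_nonneg d : (0 : ℝ) ≤ d)]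
  set p : ℝ≥0 := ∏ i, a ^ κ i
  have hp : p ≠ 0 := Finset.prod_ne_zero_iff.2 fun i _ => (NNReal.rpow_pos ha0).ne'
  refine ⟨p⁻¹ * C, fun x y θ hθ hy => ?_⟩
  have hs := relScale_nonneg x.1 (chord θ)
  calc kernelSize κ x (chord θ)
      = (p⁻¹ : ℝ≥0) * ∏ i, ENNReal.ofReal ((a * relScale x.1 (chord θ) i) ^ κ i) := by
        rw [prod_ofReal_const_mul_rpow κ a hs, ← mul_assoc, ← ENNReal.coe_mul, inv_mul_cancel₀ hp,
          ENNReal.coe_one, one_mul, kernelSize]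
    _ ≤ (p⁻¹ : ℝ≥0) * (C * Measure.pi (fun i => intertwiningFactor (κ i))
          (univ.pi fun i => Icc (1 - a * relScale x.1 (chord θ) i) 1)) := by
        gcongr
        exact hC _ (fun i => mul_nonneg a.coe_nonneg (hs i)) fun i =>
          mul_le_one₀ ha1 (hs i) (relScale_le_one x.1 (chord_pos hθ).le i)
    _ ≤ (p⁻¹ : ℝ≥0) * (C * capKernel κ x θ y) := by
        rw [capKernel_eq hκ]
        gcongr
        exact pi_Icc_subset_capParameters hθ hy a.coe_nonneg had.le
    _ = _ := by rw [ENNReal.coe_mul, mul_assoc]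

end CapKernel

section Maximal

variable {κ : Fin (d + 1) → ℝ}

lemma exists_lintegral_mul_capKernel_le (hκ : ∀ i, 0 ≤ κ i) :
    ∃ C : ℝ≥0, ∀ (g : Sph d → ℝ≥0∞) (x : Sph d), ∀ θ ∈ Ioc 0 Real.pi,
      ∫⁻ y, g y * capKernel κ x θ y ∂weightedMeasure κ ≤
        C * kernelSize κ x (chord θ) *
          ∑ ε : Fin (d + 1) → ℤˣ, ∫⁻ y in cap (signChange x ε) θ, g y ∂weightedMeasure κ := by
  obtain ⟨C, hC⟩ := exists_capKernel_le hκ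
  refine ⟨C, fun g x θ hθ => ?_⟩
  let U : Set (Sph d) := ⋃ ε : Fin (d + 1) → ℤˣ, cap (signChange x ε) θ
  have hpointwise : ∀ y, g y * capKernel κ x θ y ≤
      C * kernelSize κ x (chord θ) * U.indicator g y := fun y => by
    rcases eq_or_ne (capKernel κ x θ y) 0 with h0 | h0
    · simp [h0]
    · have hy : y ∈ U := mem_iUnion.2 (exists_mem_cap_signChange_of_capKernel_ne_zero hκ h0)
      rw [indicator_of_mem hy, mul_comm]
      gcongr
      exact hC x y θ hθ
  calc ∫⁻ y, g y * capKernel κ x θ y ∂weightedMeasure κ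
      ≤ ∫⁻ y, C * kernelSize κ x (chord θ) * U.indicator g y ∂weightedMeasure κ :=
        lintegral_mono hpointwise
    _ = C * kernelSize κ x (chord θ) * ∫⁻ y in U, g y ∂weightedMeasure κ := by
        rw [lintegral_const_mul' _ _
            (ENNReal.mul_ne_top ENNReal.coe_ne_top (kernelSize_ne_top κ x _)),
          lintegral_indicator (MeasurableSet.iUnion fun ε => measurableSet_cap _ θ)]
    _ ≤ _ := by
        gcongr
        exact (lintegral_iUnion_le _ g).trans_eq (tsum_fintype _)

lemma exists_kernelSize_mul_weightedMeasure_cap_le (hκ : ∀ i, 0 ≤ κ i) :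
    ∃ C : ℝ≥0, ∀ (x : Sph d) (ε : Fin (d + 1) → ℤˣ), ∀ θ ∈ Ioc 0 Real.pi,
      kernelSize κ x (chord θ) * weightedMeasure κ (cap (signChange x ε) θ) ≤
        C * ∫⁻ y, capKernel κ x θ y ∂weightedMeasure κ := by
  obtain ⟨C₁, hC₁⟩ := exists_weightedMeasure_closedBall_signChange_le hκ
  obtain ⟨C₂, hC₂⟩ := exists_kernelSize_le_capKernel hκ
  refine ⟨C₁ * C₂, fun x ε θ hθ => ?_⟩
  calc kernelSize κ x (chord θ) * weightedMeasure κ (cap (signChange x ε) θ)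
      ≤ kernelSize κ x (chord θ) *
          (C₁ * weightedMeasure κ (closedBall x (chord θ / 2))) := by
        rw [cap_eq_closedBall _ hθ]
        gcongr
        exact hC₁ x ε _ (chord_pos hθ) (chord_le_two θ)
    _ = C₁ * ∫⁻ _ in closedBall x (chord θ / 2), kernelSize κ x (chord θ)
          ∂weightedMeasure κ := by
        rw [setLIntegral_const, mul_left_comm]
    _ ≤ C₁ * ∫⁻ y in closedBall x (chord θ / 2), C₂ * capKernel κ x θ y
          ∂weightedMeasure κ := by
        gcongr 1
        exact setLIntegral_mono' measurableSet_closedBall fun y hy => hC₂ x y θ hθ hy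
    _ ≤ C₁ * ∫⁻ y, C₂ * capKernel κ x θ y ∂weightedMeasure κ := by
        gcongr 1
        exact setLIntegral_le_lintegral _ _
    _ = _ := by
        rw [lintegral_const_mul' _ _ ENNReal.coe_ne_top, ENNReal.coe_mul, mul_assoc]

variable {𝕜 : Type*} [RCLike 𝕜]

lemma setLIntegral_cap_le_hlMaximal_mul (hκ : ∀ i, 0 ≤ κ i) (f : Sph d → 𝕜) (x : Sph d) {θ : ℝ}
    (hθ : θ ∈ Ioc 0 Real.pi) :
    ∫⁻ y in cap x θ, ‖f y‖ₑ ∂weightedMeasure κ ≤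
      hlMaximal κ f x * weightedMeasure κ (cap x θ) := by
  have := isFiniteMeasure_weightedMeasure hκ
  rcases eq_or_ne (weightedMeasure κ (cap x θ)) 0 with h0 | h0
  · simp [setLIntegral_measure_zero _ _ h0]
  · rw [← ENNReal.div_le_iff h0 (measure_ne_top _ _)]
    exact le_iSup₂ (f := fun θ (_ : θ ∈ Ioc (0 : ℝ) Real.pi) =>
      (∫⁻ y in cap x θ, ‖f y‖ₑ ∂weightedMeasure κ) / weightedMeasure κ (cap x θ)) θ hθ

end Maximal

end ProductWeight

end

open ProductWeight in
theorem mainTheorem5_general {𝕜 : Type*} [RCLike 𝕜] (d : ℕ) (κ : Fin (d + 1) → ℝ)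
    (hκ : ∀ i, 0 ≤ κ i) :
    ∃ c : ℝ≥0, ∀ (f : Sph d → 𝕜) (x : Sph d),
      intertwiningMaximal κ f x ≤
        c * ∑ ε : Fin (d + 1) → ℤˣ, hlMaximal κ f (signChange x ε) := by
  obtain ⟨C₁, hC₁⟩ := exists_lintegral_mul_capKernel_le hκ
  obtain ⟨C₂, hC₂⟩ := exists_kernelSize_mul_weightedMeasure_cap_le hκ
  refine ⟨C₁ * C₂, fun f x => iSup₂_le fun θ hθ => ENNReal.div_le_of_le_mul ?_⟩
  set P := kernelSize κ x (chord θ)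
  set D := ∫⁻ y, capKernel κ x θ y ∂weightedMeasure κ
  calc ∫⁻ y, ‖f y‖ₑ * capKernel κ x θ y ∂weightedMeasure κ
      ≤ C₁ * P * ∑ ε, ∫⁻ y in cap (signChange x ε) θ, ‖f y‖ₑ ∂weightedMeasure κ :=
        hC₁ (fun y => ‖f y‖ₑ) x θ hθ
    _ ≤ C₁ * P * ∑ ε, hlMaximal κ f (signChange x ε) *
          weightedMeasure κ (cap (signChange x ε) θ) := by
        gcongr with ε
        exact setLIntegral_cap_le_hlMaximal_mul hκ f _ hθ
    _ = C₁ * ∑ ε, hlMaximal κ f (signChange x ε) *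
          (P * weightedMeasure κ (cap (signChange x ε) θ)) := by
        simp only [mul_assoc, Finset.mul_sum, mul_left_comm P]
    _ ≤ C₁ * ∑ ε, hlMaximal κ f (signChange x ε) * (C₂ * D) := by
        gcongr 1
        exact Finset.sum_le_sum fun ε _ => mul_le_mul_right (hC₂ x ε θ hθ) _
    _ = _ := by
        rw [← Finset.sum_mul]
        push_cast
        ring

theorem mainTheorem5 {𝕜 : Type*} [RCLike 𝕜] (d : ℕ) (κ : Fin (d + 1) → ℝ) (hκ : ∀ i, 0 ≤ κ i) :
    ∃ c : ℝ≥0, ∀ f : ProductWeight.Sph d → 𝕜,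
      Integrable f (ProductWeight.weightedMeasure κ) → ∀ x : ProductWeight.Sph d,
        ProductWeight.intertwiningMaximal κ f x ≤
          c * ∑ ε : Fin (d + 1) → ℤˣ, ProductWeight.hlMaximal κ f (ProductWeight.signChange x ε) :=
  (mainTheorem5_general d κ hκ).imp fun _ hc f _ x => hc f x
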